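/- For integers $k\ge 0$ and $n>2k$, the Kneser graph $\mathrm{KG}(n,k)$ has as vertices the $k$-element subsets of an $n$-element set, two distinct vertices being adjacent if and only if they are disjoint. A graph $G$ contains an odd $K_m$ minor if there are $m$ pairwise vertex-disjoint (non-empty) trees $T_1,\dots,T_m$ that are subgraphs of $G$, together with a $2$-colouring of their vertices, such that each $T_i$ is properly coloured and, for all $i\neq j$, some edge of $G$ joins a vertex of $T_i$ to a vertex of $T_j$ of the same colour. The odd Hadwiger conjecture holds for $G$ if, for every integer $s\ge 0$ with $\chi(G)\ge s$, the graph $G$ contains an odd $K_s$ minor. Theorem. For every integer $t$ there is an $N=N(t)$ such that for all integers $k\ge 0$ and $n\ge N$ with $n>2k$ and $n-2k+2=t$, the Kneser graph $\mathrm{KG}(n,k)$ contains an odd $K_t$ minor. Moreover, the odd Hadwiger conjecture holds for each of these graphs $\mathrm{KG}(n,k)$. (By a theorem of Lovász, $\chi(\mathrm{KG}(n,k))=n-2k+2=t$ for $k\ge 1$; this known fact is background and is not part of the assertion.) -/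

import Mathlib

/-- The Kneser graph `KG(n,k)`: the vertices are the `k`-element subsets of an `n`-element set, and
two distinct vertices are adjacent iff they are disjoint. (Distinctness is automatic for `k ≥ 1`.) -/
def kneserGraph (n k : ℕ) : SimpleGraph {s : Finset (Fin n) // s.card = k} where
  Adj a b := a ≠ b ∧ Disjoint a.1 b.1
  symm := ⟨fun _ _ h => ⟨h.1.symm, h.2.symm⟩⟩
  loopless := ⟨fun _ h => h.1 rfl⟩

/-- `G` contains an odd `K_m` minor: there are `m` pairwise vertex-disjoint trees `T i` in `G` and a
2-colouring `c` of the vertices (only its values on the trees matter) such that each tree is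
properly coloured, and any two different trees are joined by an edge of `G` whose ends have the
same colour. -/
def HasOddCompleteMinor {V : Type*} (G : SimpleGraph V) (m : ℕ) : Prop :=
  ∃ (T : Fin m → G.Subgraph) (c : V → Bool),
    (∀ i, (T i).coe.IsTree) ∧
    (∀ i j, i ≠ j → Disjoint (T i).verts (T j).verts) ∧
    (∀ i u v, (T i).Adj u v → c u ≠ c v) ∧
    (∀ i j, i ≠ j → ∃ u ∈ (T i).verts, ∃ v ∈ (T j).verts, G.Adj u v ∧ c u = c v)

/-- The odd Hadwiger conjecture holds for `G`: whenever `χ(G) ≥ s`, the graph `G` contains an odd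
`K_s` minor. -/
def SatisfiesOddHadwiger {V : Type*} (G : SimpleGraph V) : Prop :=
  ∀ s : ℕ, (s : ℕ∞) ≤ G.chromaticNumber → HasOddCompleteMinor G s

/-! Work only with the `k`-subsets of `U ∪ {z}`, where `|U| = 2 * k`, coloured by whether they
contain `z`. Two kinds of edges are used. A monochromatic edge joins `x ⊆ U` to `U \ x`. A
bichromatic edge joins `x ⊆ U` to `{z} ∪ (U \ (x ∪ {e}))`, and returning with another omitted
element exchanges one element of `x`. Hence fixing the trace on a small `F ⊆ U`, complemented when
`z` is present, leaves a bichromatically connected slice.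

Fix distinct `w`, `a i`, `b i` in `U`. The `i`-th tree spans a "row" `R i` (for `z ∉ S`: `w` absent,
`a i` the only `a`) joined to a "column" `C i` (for `z ∉ S`: `w` present, `b i` the only `b`).
Complementation in `U` joins row `i` to column `j`. For fixed `t`, large `n` makes `k` large enough
to prescribe all these elements at once, and the colouring by minima bounds `χ` by `t`. -/

/-! ### Odd minors from bichromatically connected sets -/

/-- The edges of `G` whose ends have different colours. -/
def bichromaticSubgraph {V : Type*} (G : SimpleGraph V) (c : V → Bool) : SimpleGraph V where
  Adj u v := G.Adj u v ∧ c u ≠ c v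
  symm := ⟨fun _ _ h => ⟨h.1.symm, h.2.symm⟩⟩
  loopless := ⟨fun _ h => h.2 rfl⟩

/-- Disjoint sets that are connected through bichromatic edges and pairwise joined by monochromatic
edges yield an odd complete minor. -/
theorem hasOddCompleteMinor_of_connected {V : Type*} {G : SimpleGraph V} {m : ℕ}
    (W : Fin m → Set V) (c : V → Bool)
    (hconn : ∀ i, ((bichromaticSubgraph G c).induce (W i)).Connected)
    (hdisj : ∀ i j, i ≠ j → Disjoint (W i) (W j))
    (hadj : ∀ i j, i ≠ j → ∃ u ∈ W i, ∃ v ∈ W j, G.Adj u v ∧ c u = c v) :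
    HasOddCompleteMinor G m := by
  choose T hle hT using fun i => (hconn i).exists_isTree_le
  let H : Fin m → G.Subgraph := fun i =>
    { verts := W i
      Adj := fun u v => ∃ (hu : u ∈ W i) (hv : v ∈ W i), (T i).Adj ⟨u, hu⟩ ⟨v, hv⟩
      adj_sub := fun ⟨_, _, h⟩ => (hle i h).1
      edge_vert := fun ⟨hu, _, _⟩ => hu
      symm := ⟨fun _ _ ⟨hu, hv, h⟩ => ⟨hv, hu, h.symm⟩⟩ }
  refine ⟨H, c, fun i => ?_, hdisj, fun i u v h => ?_, hadj⟩
  · have hcoe : (H i).coe = T i := by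
      ext u v
      exact ⟨fun ⟨_, _, h⟩ => h, fun h => ⟨u.2, v.2, h⟩⟩
    rw [hcoe]
    exact hT i
  · obtain ⟨_, _, h⟩ := h
    exact (hle i h).2

theorem induce_union_connected_of_adj {V : Type*} {G : SimpleGraph V} {s t : Set V} {u v : V}
    (hs : (G.induce s).Preconnected) (ht : (G.induce t).Preconnected) (hu : u ∈ s) (hv : v ∈ t)
    (huv : G.Adj u v) : (G.induce (s ∪ t)).Connected := by
  have h := SimpleGraph.induce_union_connected (SimpleGraph.induce_union_connected hs
    (SimpleGraph.induce_pair_connected_of_adj huv).preconnected ⟨u, hu, by simp⟩).preconnected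
    ht ⟨v, by simp, hv⟩
  have hset : s ∪ {u, v} ∪ t = s ∪ t := by
    ext x
    have h1 : x = u → x ∈ s := fun h => h ▸ hu
    have h2 : x = v → x ∈ t := fun h => h ▸ hv
    simp only [Set.mem_union, Set.mem_insert_iff, Set.mem_singleton_iff]
    tauto
  rwa [hset] at h

/-- An odd complete minor contains the smaller ones. -/
theorem HasOddCompleteMinor.mono {V : Type*} {G : SimpleGraph V} {s m : ℕ} (hsm : s ≤ m)
    (h : HasOddCompleteMinor G m) : HasOddCompleteMinor G s := by
  obtain ⟨T, c, htree, hdisj, hcol, hadj⟩ := h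
  have hne : ∀ i j : Fin s, i ≠ j → Fin.castLE hsm i ≠ Fin.castLE hsm j :=
    fun i j hij h => hij (Fin.castLE_injective hsm h)
  exact ⟨fun i => T (Fin.castLE hsm i), c, fun i => htree _, fun i j hij => hdisj _ _ (hne i j hij),
    fun i => hcol _, fun i j hij => hadj _ _ (hne i j hij)⟩

/-! ### Upper bound on the chromatic number -/

/-- The standard proper colouring of the Kneser graph by truncated minima. -/
theorem kneserGraph_colorable {n k : ℕ} (hk : 0 < k) (hn : 2 * k ≤ n) :
    (kneserGraph n k).Colorable (n - 2 * k + 2) := by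
  have hne : ∀ S : {s : Finset (Fin n) // s.card = k}, S.1.Nonempty := fun S =>
    Finset.card_pos.mp (by rw [S.2]; exact hk)
  refine ⟨SimpleGraph.Coloring.mk
    (fun S => ⟨min (S.1.min' (hne S)).1 (n - 2 * k + 1), by omega⟩) ?_⟩
  rintro S S' ⟨_, hdis⟩ heq
  rw [Fin.mk.injEq] at heq
  have hm := S.1.min'_mem (hne S)
  have hm' := S'.1.min'_mem (hne S')
  by_cases hlt : (S.1.min' (hne S)).1 < n - 2 * k + 1
  · have : S.1.min' (hne S) = S'.1.min' (hne S') := by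
      apply Fin.ext
      omega
    exact Finset.disjoint_left.mp hdis hm (this ▸ hm')
  -- In the last colour class all sets lie among the top `2 * k - 1` elements, too few for two
  -- disjoint `k`-sets.
  · have hsub : (S.1 ∪ S'.1).map Fin.valEmbedding ⊆ Finset.Ico (n - 2 * k + 1) n := by
      intro x hx
      obtain ⟨y, hy, rfl⟩ := Finset.mem_map.mp hx
      rw [Finset.mem_Ico]
      refine ⟨?_, y.2⟩
      rcases Finset.mem_union.mp hy with hy | hy
      · have : (S.1.min' (hne S)).1 ≤ y.1 := S.1.min'_le y hy
        simp only [Fin.valEmbedding_apply]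
        omega
      · have : (S'.1.min' (hne S')).1 ≤ y.1 := S'.1.min'_le y hy
        simp only [Fin.valEmbedding_apply]
        omega
    have hcard := Finset.card_le_card hsub
    rw [Finset.card_map, Finset.card_union_of_disjoint hdis, S.2, S'.2, Nat.card_Ico] at hcard
    omega

/-! ### Connectivity of slices -/

/-- The 2-colouring of the vertices of the Kneser graph according to whether they contain `z`. -/
def containsColoring {n : ℕ} (k : ℕ) (z : Fin n) (S : {s : Finset (Fin n) // s.card = k}) : Bool :=
  decide (z ∈ S.1)

/-- The vertices `S ⊆ U ∪ {z}` that meet `F` in `P` if `z ∉ S`, and in `F \ P` if `z ∈ S`. -/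
def kneserSlice {n : ℕ} (k : ℕ) (z : Fin n) (U F P : Finset (Fin n)) :
    Set {s : Finset (Fin n) // s.card = k} :=
  {S | S.1 ⊆ insert z U ∧ ∀ e ∈ F, (e ∈ S.1 ↔ (z ∈ S.1 ↔ e ∉ P))}

section

variable {n k : ℕ} {z : Fin n} {U : Finset (Fin n)}

theorem card_insert_sdiff_insert (hU : U.card = 2 * k) (hz : z ∉ U) {x : Finset (Fin n)}
    (hx : x.card = k) (hxU : x ⊆ U) {e : Fin n} (he : e ∈ U) (hex : e ∉ x) :
    (insert z (U \ insert e x)).card = k := by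
  have hsub : insert e x ⊆ U := Finset.insert_subset he hxU
  have hle := Finset.card_le_card hsub
  rw [Finset.card_insert_of_notMem (by simp [hz]), Finset.card_sdiff_of_subset hsub,
    Finset.card_insert_of_notMem hex]
  rw [Finset.card_insert_of_notMem hex] at hle
  omega

/-- Crossing a bichromatic edge complements the trace on `F` as long as the omitted element of `U`
lies outside `F`, which is what the twist in the slice allows. Two such crossings exchange one
element outside `F`, and exchanges connect all sets avoiding `z`. -/
theorem kneserSlice_preconnected (hU : U.card = 2 * k) (hz : z ∉ U) {F P : Finset (Fin n)}
    (hF : F ⊆ U) (hFk : F.card ≤ k) :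
    ((bichromaticSubgraph (kneserGraph n k) (containsColoring k z)).induce
      (kneserSlice k z U F P)).Preconnected := by
  set G := (bichromaticSubgraph (kneserGraph n k) (containsColoring k z)).induce
      (kneserSlice k z U F P)
  have hadj : ∀ S S' : kneserSlice k z U F P, z ∉ S.1.1 → z ∈ S'.1.1 → Disjoint S.1.1 S'.1.1 →
      G.Adj S S' := by
    intro S S' hS hS' hd
    refine ⟨⟨fun h => ?_, hd⟩, ?_⟩
    · have h' : S.1 = S'.1 := h
      exact hS (h' ▸ hS')
    · simp [containsColoring, hS, hS']
  have hswap : ∀ d, ∀ S S' : kneserSlice k z U F P, z ∉ S.1.1 → z ∉ S'.1.1 →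
      (S.1.1 \ S'.1.1).card = d → G.Reachable S S' := by
    intro d
    induction d with
    | zero =>
      intro S S' _ _ hd
      have hsub : S.1.1 ⊆ S'.1.1 := by
        rwa [Finset.card_eq_zero, Finset.sdiff_eq_empty_iff_subset] at hd
      have : S = S' := Subtype.ext (Subtype.ext
        (Finset.eq_of_subset_of_card_le hsub (by rw [S.1.2, S'.1.2])))
      rw [this]
    | succ d ih =>
      intro S S' hS hS' hd
      have hd' : (S'.1.1 \ S.1.1).card = d + 1 := by
        rw [← hd]
        exact Finset.card_sdiff_comm (by rw [S.1.2, S'.1.2])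
      obtain ⟨f, hf⟩ := Finset.card_pos.mp (hd.symm ▸ Nat.succ_pos d : 0 < (S.1.1 \ S'.1.1).card)
      obtain ⟨e, he⟩ := Finset.card_pos.mp (hd'.symm ▸ Nat.succ_pos d : 0 < (S'.1.1 \ S.1.1).card)
      rw [Finset.mem_sdiff] at he hf
      have hSU : S.1.1 ⊆ U := (Finset.subset_insert_iff_of_notMem hS).mp S.2.1
      have hSU' : S'.1.1 ⊆ U := (Finset.subset_insert_iff_of_notMem hS').mp S'.2.1
      have hSF := S.2.2
      have hSF' := S'.2.2
      have hfF : f ∉ F := fun h => by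
        have := hSF f h
        have := hSF' f h
        tauto
      have heF : e ∉ F := fun h => by
        have := hSF e h
        have := hSF' e h
        tauto
      -- The path is `S`, then `{z} ∪ (U \ (S ∪ {e}))`, then `S` with `f` replaced by `e`, which is
      -- one element closer to `S'`.
      have hMcard := card_insert_sdiff_insert hU hz S.1.2 hSU (hSU' he.1) he.2
      have hM : (⟨_, hMcard⟩ : {s : Finset (Fin n) // s.card = k}) ∈ kneserSlice k z U F P := by
        refine ⟨Finset.insert_subset_insert _ Finset.sdiff_subset, fun a ha => ?_⟩
        have haU := hF ha
        have := hSF a ha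
        have haz : a ≠ z := fun h => hz (h ▸ haU)
        have hae : a ≠ e := fun h => heF (h ▸ ha)
        simp only [Finset.mem_insert, Finset.mem_sdiff]
        tauto
      have hTcard : (insert e (S.1.1.erase f)).card = k := by
        rw [Finset.card_insert_of_notMem (by simp [he.2]), Finset.card_erase_add_one hf.1, S.1.2]
      have hzT : z ∉ insert e (S.1.1.erase f) := by
        rw [Finset.mem_insert, Finset.mem_erase]
        rintro (h | h)
        · exact hz (h ▸ hSU' he.1)
        · exact hS h.2
      have hT : (⟨_, hTcard⟩ : {s : Finset (Fin n) // s.card = k}) ∈ kneserSlice k z U F P := by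
        refine ⟨?_, fun a ha => ?_⟩
        · intro a ha
          rcases Finset.mem_insert.mp ha with h | h
          · exact h ▸ Finset.mem_insert_of_mem (hSU' he.1)
          · exact S.2.1 (Finset.mem_of_mem_erase h)
        · have := hSF a ha
          have hae : a ≠ e := fun h => heF (h ▸ ha)
          have haf : a ≠ f := fun h => hfF (h ▸ ha)
          have : a ∈ insert e (S.1.1.erase f) ↔ a ∈ S.1.1 := by
            simp [hae, haf]
          simp only [hzT, this]
          tauto
      have h1 : G.Adj S ⟨_, hM⟩ := by
        refine hadj _ _ hS (by simp) (Finset.disjoint_left.mpr fun a ha => ?_)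
        have haz : a ≠ z := fun h => hS (h ▸ ha)
        simp [haz, ha]
      have h2 : G.Adj ⟨_, hT⟩ ⟨_, hM⟩ := by
        refine hadj _ _ hzT (by simp) (Finset.disjoint_left.mpr fun a ha => ?_)
        have haz : a ≠ z := fun h => hzT (h ▸ ha)
        have : a = e ∨ a ∈ S.1.1 := by
          rcases Finset.mem_insert.mp ha with h | h
          · exact Or.inl h
          · exact Or.inr (Finset.mem_of_mem_erase h)
        simp only [Finset.mem_insert, Finset.mem_sdiff]
        tauto
      refine (h1.reachable.trans h2.symm.reachable).trans (ih _ _ hzT hS' ?_)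
      have : insert e (S.1.1.erase f) \ S'.1.1 = (S.1.1 \ S'.1.1).erase f := by
        ext a
        simp only [Finset.mem_sdiff, Finset.mem_insert, Finset.mem_erase]
        have : a = e → a ∈ S'.1.1 := fun h => h ▸ he.1
        tauto
      rw [this, Finset.card_erase_of_mem (Finset.mem_sdiff.mpr hf), hd]
      rfl
  have hdown : ∀ S : kneserSlice k z U F P, ∃ S' : kneserSlice k z U F P, z ∉ S'.1.1 ∧
      G.Reachable S S' := by
    intro S
    by_cases hS : z ∈ S.1.1
    · have hcard : (U \ S.1.1).card = k + 1 := by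
        have h1 : U \ S.1.1 = U \ S.1.1.erase z := by
          ext a
          have : a ∈ U → a ≠ z := fun h h' => hz (h' ▸ h)
          simp only [Finset.mem_sdiff, Finset.mem_erase]
          tauto
        have h2 : S.1.1.erase z ⊆ U := Finset.subset_insert_iff.mp S.2.1
        have h3 := Finset.card_pos.mpr ⟨z, hS⟩
        rw [S.1.2] at h3
        rw [h1, Finset.card_sdiff_of_subset h2, Finset.card_erase_of_mem hS, S.1.2, hU]
        omega
      -- This is where `F.card ≤ k` is needed: some element of the `(k + 1)`-set `U \ S` can be
      -- dropped without touching `F`.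
      obtain ⟨e, he, heF⟩ := Finset.exists_mem_notMem_of_card_lt_card
        (show F.card < (U \ S.1.1).card by omega)
      have hTcard : ((U \ S.1.1).erase e).card = k := by
        rw [Finset.card_erase_of_mem he, hcard]
        rfl
      have hzT : z ∉ (U \ S.1.1).erase e := by simp [hz]
      have hT : (⟨_, hTcard⟩ : {s : Finset (Fin n) // s.card = k}) ∈ kneserSlice k z U F P := by
        refine ⟨fun a ha => ?_, fun a ha => ?_⟩
        · exact Finset.mem_insert_of_mem (Finset.mem_sdiff.mp (Finset.mem_of_mem_erase ha)).1
        · have := S.2.2 a ha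
          have haU := hF ha
          have hae : a ≠ e := fun h => heF (h ▸ ha)
          simp only [hzT]
          simp only [Finset.mem_erase, Finset.mem_sdiff]
          tauto
      refine ⟨⟨_, hT⟩, hzT, (SimpleGraph.Adj.reachable (hadj _ _ hzT hS ?_)).symm⟩
      exact Finset.disjoint_left.mpr fun a ha =>
        (Finset.mem_sdiff.mp (Finset.mem_of_mem_erase ha)).2
    · exact ⟨S, hS, SimpleGraph.Reachable.refl _⟩
  intro S S'
  obtain ⟨T, hT, hST⟩ := hdown S
  obtain ⟨T', hT', hST'⟩ := hdown S'
  exact (hST.trans (hswap _ _ _ hT hT' rfl)).trans hST'.symm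

/-- Half of a `2k`-element set with a prescribed trace on a small part. -/
theorem exists_card_eq_of_trace (hU : U.card = 2 * k) {F P : Finset (Fin n)} (hF : F ⊆ U)
    (hFk : F.card ≤ k) (hP : P ⊆ F) :
    ∃ x ⊆ U, x.card = k ∧ ∀ e ∈ F, (e ∈ x ↔ e ∈ P) := by
  have hdis : Disjoint P (U \ F) :=
    Finset.disjoint_left.mpr fun a ha h => (Finset.mem_sdiff.mp h).2 (hP ha)
  have hPk := (Finset.card_le_card hP).trans hFk
  obtain ⟨x, hPx, hx, hxk⟩ := Finset.exists_subsuperset_card_eq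
    (s := P) (t := P ∪ (U \ F)) (n := k) Finset.subset_union_left hPk
    (by rw [Finset.card_union_of_disjoint hdis, Finset.card_sdiff_of_subset hF]; omega)
  refine ⟨x, hx.trans (Finset.union_subset (hP.trans hF) Finset.sdiff_subset), hxk,
    fun e he => ⟨fun h => ?_, fun h => hPx h⟩⟩
  rcases Finset.mem_union.mp (hx h) with h | h
  · exact h
  · exact absurd he (Finset.mem_sdiff.mp h).2

/-! ### Rows, columns and the minor -/

/-- Kneser graphs with large `k` contain large odd complete minors. -/
theorem kneserGraph_hasOddCompleteMinor {m : ℕ} (hm : 2 * m + 1 ≤ k) (hn : 2 * k < n) :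
    HasOddCompleteMinor (kneserGraph n k) m := by
  let z : Fin n := ⟨2 * k, hn⟩
  let w : Fin n := ⟨2 * m, by omega⟩
  let a : Fin m → Fin n := fun i => ⟨i, by omega⟩
  let b : Fin m → Fin n := fun i => ⟨m + i, by omega⟩
  let U : Finset (Fin n) := Finset.Iio z
  let A : Finset (Fin n) := Finset.univ.image a
  let B : Finset (Fin n) := Finset.univ.image b
  have hU : U.card = 2 * k := Fin.card_Iio z
  have hz : z ∉ U := by simp [U]
  have hwU : w ∈ U := Finset.mem_Iio.mpr (Fin.mk_lt_mk.mpr (by omega))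
  have haU : ∀ i, a i ∈ U := fun i => Finset.mem_Iio.mpr (Fin.mk_lt_mk.mpr (by omega))
  have hbU : ∀ i, b i ∈ U := fun i => Finset.mem_Iio.mpr (Fin.mk_lt_mk.mpr (by omega))
  have hab : ∀ i j, a i ≠ b j := fun i j h => by simp [a, b, Fin.ext_iff] at h; omega
  have haw : ∀ i, a i ≠ w := fun i h => by simp [a, w, Fin.ext_iff] at h; omega
  have hbw : ∀ i, b i ≠ w := fun i h => by simp [b, w, Fin.ext_iff] at h; omega
  have ha : ∀ i j, a i = a j → i = j := fun i j h => by simp [a, Fin.ext_iff] at h; omega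
  have hb : ∀ i j, b i = b j → i = j := fun i j h => by simp [b, Fin.ext_iff] at h; omega
  have hAU : A ⊆ U := Finset.image_subset_iff.mpr fun i _ => haU i
  have hBU : B ⊆ U := Finset.image_subset_iff.mpr fun i _ => hbU i
  have haA : ∀ i, a i ∈ A := fun i => Finset.mem_image_of_mem _ (Finset.mem_univ _)
  have hbB : ∀ i, b i ∈ B := fun i => Finset.mem_image_of_mem _ (Finset.mem_univ _)
  have hA : ∀ e ∈ A, ∃ i, e = a i := fun e he => by
    obtain ⟨i, _, h⟩ := Finset.mem_image.mp he
    exact ⟨i, h.symm⟩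
  have hB : ∀ e ∈ B, ∃ i, e = b i := fun e he => by
    obtain ⟨i, _, h⟩ := Finset.mem_image.mp he
    exact ⟨i, h.symm⟩
  have hAc : A.card ≤ m := Finset.card_image_le.trans (by simp)
  have hBc : B.card ≤ m := Finset.card_image_le.trans (by simp)
  have hFA : (insert w A).card ≤ k := (Finset.card_insert_le _ _).trans (by omega)
  have hFB : (insert w B).card ≤ k := (Finset.card_insert_le _ _).trans (by omega)
  have hFAB : (insert w (A ∪ B)).card ≤ k :=
    (Finset.card_insert_le _ _).trans (by have := Finset.card_union_le A B; omega)
  have hFABU : insert w (A ∪ B) ⊆ U := Finset.insert_subset hwU (Finset.union_subset hAU hBU)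
  let R : Fin m → Set {s : Finset (Fin n) // s.card = k} := fun i =>
    kneserSlice k z U (insert w A) {a i}
  let C : Fin m → Set {s : Finset (Fin n) // s.card = k} := fun i =>
    kneserSlice k z U (insert w B) {w, b i}
  have hR : ∀ i (x : {s : Finset (Fin n) // s.card = k}), x.1 ⊆ U → w ∉ x.1 →
      (∀ j, a j ∈ x.1 ↔ j = i) → x ∈ R i := by
    intro i x hx hwx hax
    have hzx : z ∉ x.1 := fun h => hz (hx h)
    refine ⟨hx.trans (Finset.subset_insert _ _), fun e he => ?_⟩
    rcases Finset.mem_insert.mp he with rfl | he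
    · simp [hwx, hzx, (haw i).symm]
    · obtain ⟨j, rfl⟩ := hA e he
      simp only [hzx, hax, Finset.mem_singleton]
      have : a j = a i ↔ j = i := ⟨ha j i, fun h => h ▸ rfl⟩
      tauto
  have hC : ∀ i (x : {s : Finset (Fin n) // s.card = k}), x.1 ⊆ U → w ∈ x.1 →
      (∀ j, b j ∈ x.1 ↔ j = i) → x ∈ C i := by
    intro i x hx hwx hbx
    have hzx : z ∉ x.1 := fun h => hz (hx h)
    refine ⟨hx.trans (Finset.subset_insert _ _), fun e he => ?_⟩
    rcases Finset.mem_insert.mp he with rfl | he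
    · simp [hwx, hzx]
    · obtain ⟨j, rfl⟩ := hB e he
      simp only [hzx, hbx, Finset.mem_singleton, Finset.mem_insert]
      have : b j = b i ↔ j = i := ⟨hb j i, fun h => h ▸ rfl⟩
      have := hbw j
      tauto
  have hzw : z ≠ w := fun h => hz (h ▸ hwU)
  have hCz : ∀ i (x : {s : Finset (Fin n) // s.card = k}), x.1 ⊆ insert z U → z ∈ x.1 →
      w ∉ x.1 → (∀ j, b j ∈ x.1 ↔ j ≠ i) → x ∈ C i := by
    intro i x hx hzx hwx hbx
    refine ⟨hx, fun e he => ?_⟩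
    rcases Finset.mem_insert.mp he with rfl | he
    · simp [hwx, hzx]
    · obtain ⟨j, rfl⟩ := hB e he
      simp only [hzx, hbx, Finset.mem_singleton, Finset.mem_insert]
      have : b j = b i ↔ j = i := ⟨hb j i, fun h => h ▸ rfl⟩
      have := hbw j
      tauto
  refine hasOddCompleteMinor_of_connected (fun i => R i ∪ C i) (containsColoring k z) ?_ ?_ ?_
  · intro i
    obtain ⟨x, hxU, hxk, hx⟩ := exists_card_eq_of_trace hU hFABU hFAB
      (P := {a i, b i}) (by
        simp [Finset.insert_subset_iff, haA, hbB])
    have hwx : w ∉ x := by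
      rw [hx w (by simp)]; simp [(haw i).symm, (hbw i).symm]
    have hax : ∀ j, a j ∈ x ↔ j = i := fun j => by
      rw [hx _ (by simp [haA])]
      simp only [Finset.mem_insert, Finset.mem_singleton, hab, or_false]
      exact ⟨ha j i, fun h => h ▸ rfl⟩
    have hbx : ∀ j, b j ∈ x ↔ j = i := fun j => by
      rw [hx _ (by simp [hbB])]
      simp only [Finset.mem_insert, Finset.mem_singleton, (hab _ _).symm, false_or]
      exact ⟨hb j i, fun h => h ▸ rfl⟩
    -- Omitting `w` itself crosses from row to column: `w` is then absent on both sides, which means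
    -- "row" without `z` and "column" with `z`.
    have hycard := card_insert_sdiff_insert hU hz hxk hxU hwU hwx
    refine induce_union_connected_of_adj
      (u := ⟨x, hxk⟩) (v := ⟨_, hycard⟩)
      (kneserSlice_preconnected hU hz (Finset.insert_subset hwU hAU) hFA)
      (kneserSlice_preconnected hU hz (Finset.insert_subset hwU hBU) hFB)
      (hR i _ hxU hwx hax) (hCz i _ ?_ ?_ ?_ ?_) ?_
    · exact Finset.insert_subset_insert _ Finset.sdiff_subset
    · simp
    · simp [hzw.symm]
    · intro j
      have hbz : b j ≠ z := fun h => hz (h ▸ hbU j)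
      simp [hbz, hbU, hbw, hbx]
    · have hzx : z ∉ x := fun h => hz (hxU h)
      refine ⟨⟨fun h => ?_, Finset.disjoint_left.mpr fun e he => ?_⟩, ?_⟩
      · exact hzx (by rw [Subtype.mk.inj h]; simp)
      · have hez : e ≠ z := fun h => hzx (h ▸ he)
        simp [hez, he]
      · simp [containsColoring, hzx]
  · intro i j hij
    rw [Set.disjoint_left]
    rintro x (hi | hi) (hj | hj)
    · have h1 := hi.2 (a i) (by simp [haA])
      have h2 := hj.2 (a i) (by simp [haA])
      have : a i ≠ a j := fun h => hij (ha i j h)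
      simp only [Finset.mem_singleton] at h1 h2
      tauto
    · have h1 := hi.2 w (by simp)
      have h2 := hj.2 w (by simp)
      have := (haw i).symm
      simp only [Finset.mem_singleton, Finset.mem_insert] at h1 h2
      tauto
    · have h1 := hi.2 w (by simp)
      have h2 := hj.2 w (by simp)
      have := (haw j).symm
      simp only [Finset.mem_singleton, Finset.mem_insert] at h1 h2
      tauto
    · have h1 := hi.2 (b i) (by simp [hbB])
      have h2 := hj.2 (b i) (by simp [hbB])
      have : b i ≠ b j := fun h => hij (hb i j h)
      have := hbw i
      simp only [Finset.mem_singleton, Finset.mem_insert] at h1 h2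
      tauto
  · intro i j hij
    -- Chosen so that `x` lies in row `i`, while `U \ x` contains `w` and, among the `b`'s, only `b
    -- j`, hence lies in column `j`.
    obtain ⟨x, hxU, hxk, hx⟩ := exists_card_eq_of_trace hU hFABU hFAB
      (P := insert (a i) (B.erase (b j))) (by
        intro e he
        rcases Finset.mem_insert.mp he with rfl | he
        · simp [haA]
        · simp [Finset.mem_of_mem_erase he])
    have hwx : w ∉ x := by
      rw [hx w (by simp)]
      simp only [Finset.mem_insert, (haw i).symm, false_or]
      intro h
      obtain ⟨l, hl⟩ := hB w (Finset.mem_of_mem_erase h)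
      exact hbw l hl.symm
    have hax : ∀ l, a l ∈ x ↔ l = i := fun l => by
      have hlB : a l ∉ B := fun h => by
        obtain ⟨l', hl⟩ := hB _ h
        exact hab _ _ hl
      rw [hx _ (by simp [haA])]
      simp only [Finset.mem_insert, Finset.mem_erase, hlB, and_false, or_false]
      exact ⟨ha l i, fun h => h ▸ rfl⟩
    have hbx : ∀ l, b l ∈ x ↔ l ≠ j := fun l => by
      rw [hx _ (by simp [hbB])]
      simp only [Finset.mem_insert, Finset.mem_erase, hbB, and_true, (hab _ _).symm, false_or]
      exact not_congr ⟨hb l j, fun h => h ▸ rfl⟩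
    have hyk : (U \ x).card = k := by
      rw [Finset.card_sdiff_of_subset hxU]; omega
    refine ⟨⟨x, hxk⟩, Or.inl (hR i _ hxU hwx hax), ⟨U \ x, hyk⟩,
      Or.inr (hC j _ Finset.sdiff_subset (by simp [hwU, hwx]) fun l => ?_), ⟨fun h => ?_, ?_⟩, ?_⟩
    · simp [hbU, hbx]
    · have := Subtype.mk.inj h
      exact hwx (by rw [this]; simp [hwU, hwx])
    · exact Finset.disjoint_sdiff
    · have hzx : z ∉ x := fun h => hz (hxU h)
      simp [containsColoring, hzx, hz]

end

theorem mainTheorem3 (t : ℕ) :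
    ∃ N : ℕ, ∀ n k : ℕ, N ≤ n → 2 * k < n → t = n - 2 * k + 2 →
      HasOddCompleteMinor (kneserGraph n k) t ∧ SatisfiesOddHadwiger (kneserGraph n k) := by
  -- From `2 * k = n - t + 2 ≥ 4 * t + 4` follows `2 * t + 1 ≤ k`; the constant is not optimised.
  refine ⟨5 * t + 2, fun n k hN hn ht => ?_⟩
  have hminor : HasOddCompleteMinor (kneserGraph n k) t :=
    kneserGraph_hasOddCompleteMinor (by omega) hn
  refine ⟨hminor, fun s hs => hminor.mono ?_⟩
  have hcol : (kneserGraph n k).chromaticNumber ≤ (t : ℕ∞) :=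
    ht ▸ (kneserGraph_colorable (by omega) hn.le).chromaticNumber_le
  exact_mod_cast hs.trans hcol
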